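/- Let $(M_n)_{n\ge 0}$ be a weight sequence, that is, a sequence of positive real numbers with $M_0=1$ and $\frac{M_{n+m}}{M_nM_m}\ge\binom{n+m}{n}$ for all integers $n,m\ge 0$. Let $D([0,1],M)$ be the algebra, under pointwise operations, of all infinitely differentiable functions $f:[0,1]\to\mathbb{C}$ (with one-sided derivatives at the end points) such that $$\|f\|_D=\sum_{n=0}^\infty\frac{\|f^{(n)}\|_\infty}{M_n}<\infty,$$ where $\|\cdot\|_\infty$ is the supremum norm on $[0,1]$, and equip it with the norm $\|\cdot\|_D$. Let $\phi:[0,1]\to[0,1]$ be a map that induces a compact endomorphism $T$ of $D([0,1],M)$; that is, $f\circ\phi\in D([0,1],M)$ for every $f\in D([0,1],M)$, and the algebra endomorphism $Tf=f\circ\phi$ is a compact operator with respect to $\|\cdot\|_D$. Then every non-zero eigenvalue $\lambda\in\mathbb{C}$ of $T$ has geometric multiplicity one: the eigenspace $\{f\in D([0,1],M): f\circ\phi=\lambda f\}$ has complex dimension $1$. -/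

import Mathlib

open Set
open scoped ContDiff

noncomputable section

/-- A weight sequence: positive reals `M 0 = 1, M 1, M 2, …` with
`M (n + m) / (M n * M m) ≥ (n + m).choose n` for all `n`, `m`. -/
structure WeightSequence where
  /-- the terms of the sequence -/
  toFun : ℕ → ℝ
  pos : ∀ n, 0 < toFun n
  zero_eq_one : toFun 0 = 1
  choose_le : ∀ n m, ((n + m).choose n : ℝ) ≤ toFun (n + m) / (toFun n * toFun m)

instance : CoeFun WeightSequence (fun _ => ℕ → ℝ) := ⟨WeightSequence.toFun⟩

namespace DSpace

/-- A function on `[0,1]`, extended to `ℝ` by its end values. Only its values on `[0,1]` matter,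
because it is only differentiated within `[0,1]` below. -/
def extend (f : Icc (0 : ℝ) 1 → ℂ) : ℝ → ℂ := IccExtend zero_le_one f

/-- `f ∈ C^∞([0,1])`, with one-sided derivatives at the end points. -/
def IsSmooth (f : Icc (0 : ℝ) 1 → ℂ) : Prop := ContDiffOn ℝ ∞ (extend f) (Icc 0 1)

/-- The `n`-th derivative of `f` on `[0,1]`, one-sided at the end points. -/
def deriv (n : ℕ) (f : Icc (0 : ℝ) 1 → ℂ) (x : Icc (0 : ℝ) 1) : ℂ :=
  iteratedDerivWithin n (extend f) (Icc 0 1) x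

/-- `‖f^{(n)}‖_∞`, the supremum over `[0,1]`. -/
def supDeriv (n : ℕ) (f : Icc (0 : ℝ) 1 → ℂ) : ℝ := ⨆ x, ‖deriv n f x‖

/-- `f ∈ D([0,1], M)`: `f` is smooth and `∑ ‖f^{(n)}‖_∞ / M n < ∞`. -/
def Mem (M : WeightSequence) (f : Icc (0 : ℝ) 1 → ℂ) : Prop :=
  IsSmooth f ∧ Summable fun n => supDeriv n f / M n

/-- `‖f‖_D = ∑ ‖f^{(n)}‖_∞ / M n`. -/
def dnorm (M : WeightSequence) (f : Icc (0 : ℝ) 1 → ℂ) : ℝ := ∑' n, supDeriv n f / M n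

theorem uniqueDiff : UniqueDiffOn ℝ (Icc (0 : ℝ) 1) := uniqueDiffOn_Icc zero_lt_one

theorem IsSmooth.at {f : Icc (0 : ℝ) 1 → ℂ} (hf : IsSmooth f) (n : ℕ) (x : Icc (0 : ℝ) 1) :
    ContDiffWithinAt ℝ n (extend f) (Icc 0 1) x :=
  (hf x x.2).of_le (by exact_mod_cast le_top)

theorem deriv_add {f g : Icc (0 : ℝ) 1 → ℂ} (hf : IsSmooth f) (hg : IsSmooth g) (n : ℕ)
    (x : Icc (0 : ℝ) 1) : deriv n (f + g) x = deriv n f x + deriv n g x :=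
  iteratedDerivWithin_add x.2 uniqueDiff (hf.at n x) (hg.at n x)

theorem deriv_smul {f : Icc (0 : ℝ) 1 → ℂ} (hf : IsSmooth f) (c : ℂ) (n : ℕ)
    (x : Icc (0 : ℝ) 1) : deriv n (c • f) x = c • deriv n f x :=
  iteratedDerivWithin_const_smul x.2 uniqueDiff c (hf.at n x)

theorem deriv_const (c : ℂ) (n : ℕ) (x : Icc (0 : ℝ) 1) :
    deriv n (fun _ => c) x = if n = 0 then c else 0 :=
  iteratedDerivWithin_const

theorem norm_deriv_mul_le {f g : Icc (0 : ℝ) 1 → ℂ} (hf : IsSmooth f) (hg : IsSmooth g) (n : ℕ)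
    (x : Icc (0 : ℝ) 1) : ‖deriv n (f * g) x‖ ≤
      ∑ i ∈ Finset.range (n + 1), (n.choose i : ℝ) * ‖deriv i f x‖ * ‖deriv (n - i) g x‖ := by
  have h := norm_iteratedFDerivWithin_mul_le (n := n) hf hg uniqueDiff x.2
    (by exact_mod_cast le_top)
  simp only [norm_iteratedFDerivWithin_eq_norm_iteratedDerivWithin] at h
  exact h

theorem IsSmooth.norm_le {f : Icc (0 : ℝ) 1 → ℂ} (hf : IsSmooth f) (n : ℕ)
    (x : Icc (0 : ℝ) 1) : ‖deriv n f x‖ ≤ supDeriv n f := by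
  have hc : ContinuousOn (iteratedDerivWithin n (extend f) (Icc 0 1)) (Icc (0 : ℝ) 1) :=
    ContDiffOn.continuousOn_iteratedDerivWithin hf (by exact_mod_cast le_top) uniqueDiff
  have hc' : Continuous fun x : Icc (0 : ℝ) 1 => ‖deriv n f x‖ :=
    (continuousOn_iff_continuous_domRestrict.1 hc).norm
  exact le_ciSup (isCompact_range hc').bddAbove x

theorem supDeriv_nonneg (n : ℕ) (f : Icc (0 : ℝ) 1 → ℂ) : 0 ≤ supDeriv n f :=
  Real.iSup_nonneg fun _ => norm_nonneg _

theorem supDeriv_le {f : Icc (0 : ℝ) 1 → ℂ} {n : ℕ} {C : ℝ} (h : ∀ x, ‖deriv n f x‖ ≤ C) :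
    supDeriv n f ≤ C :=
  ciSup_le h

theorem supDeriv_const (c : ℂ) (n : ℕ) :
    supDeriv n (fun _ => c) = if n = 0 then ‖c‖ else 0 := by
  simp only [supDeriv, deriv_const]
  split_ifs <;> simp

theorem supDeriv_add_le {f g : Icc (0 : ℝ) 1 → ℂ} (hf : IsSmooth f) (hg : IsSmooth g) (n : ℕ) :
    supDeriv n (f + g) ≤ supDeriv n f + supDeriv n g :=
  supDeriv_le fun x => by
    rw [deriv_add hf hg]
    exact (norm_add_le _ _).trans (add_le_add (hf.norm_le n x) (hg.norm_le n x))

theorem supDeriv_smul {f : Icc (0 : ℝ) 1 → ℂ} (hf : IsSmooth f) (c : ℂ) (n : ℕ) :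
    supDeriv n (c • f) = ‖c‖ * supDeriv n f := by
  simp only [supDeriv, deriv_smul hf, norm_smul]
  exact (Real.mul_iSup_of_nonneg (norm_nonneg c) _).symm

theorem supDeriv_mul_div_le (M : WeightSequence) {f g : Icc (0 : ℝ) 1 → ℂ} (hf : IsSmooth f)
    (hg : IsSmooth g) (n : ℕ) : supDeriv n (f * g) / M n ≤
      ∑ i ∈ Finset.range (n + 1), (supDeriv i f / M i) * (supDeriv (n - i) g / M (n - i)) := by
  rw [div_le_iff₀ (M.pos n), Finset.sum_mul]
  refine supDeriv_le fun x => (norm_deriv_mul_le hf hg n x).trans (Finset.sum_le_sum fun i hi => ?_)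
  have hin : i + (n - i) = n := by
    have := Finset.mem_range.1 hi
    omega
  have hM := M.choose_le i (n - i)
  rw [hin] at hM
  have h1 : ‖deriv i f x‖ * ‖deriv (n - i) g x‖ ≤ supDeriv i f * supDeriv (n - i) g :=
    mul_le_mul (hf.norm_le i x) (hg.norm_le _ x) (norm_nonneg _) (supDeriv_nonneg _ _)
  calc (n.choose i : ℝ) * ‖deriv i f x‖ * ‖deriv (n - i) g x‖
      = (n.choose i : ℝ) * (‖deriv i f x‖ * ‖deriv (n - i) g x‖) := by ring
    _ ≤ (M n / (M i * M (n - i))) * (supDeriv i f * supDeriv (n - i) g) :=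
        mul_le_mul hM h1 (by positivity) (le_trans (Nat.cast_nonneg _) hM)
    _ = _ := by
        have := (M.pos i).ne'
        have := (M.pos (n - i)).ne'
        field_simp

theorem term_nonneg (M : WeightSequence) (f : Icc (0 : ℝ) 1 → ℂ) (n : ℕ) :
    0 ≤ supDeriv n f / M n :=
  div_nonneg (supDeriv_nonneg n f) (M.pos n).le

theorem hasSum_const (M : WeightSequence) (c : ℂ) :
    HasSum (fun n => supDeriv n (fun _ => c) / M n) ‖c‖ := by
  have h := hasSum_ite_eq (0 : ℕ) ‖c‖
  convert h using 2 with n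
  rw [supDeriv_const]
  split_ifs with hn
  · simp [hn, M.zero_eq_one]
  · simp

theorem mem_const (M : WeightSequence) (c : ℂ) : Mem M (fun _ => c) :=
  ⟨contDiffOn_const, (hasSum_const M c).summable⟩

theorem Mem.add_le {M : WeightSequence} {f g : Icc (0 : ℝ) 1 → ℂ} (hf : Mem M f) (hg : Mem M g)
    (n : ℕ) : supDeriv n (f + g) / M n ≤ supDeriv n f / M n + supDeriv n g / M n := by
  rw [← add_div]
  exact div_le_div_of_nonneg_right (supDeriv_add_le hf.1 hg.1 n) (M.pos n).le

theorem Mem.add {M : WeightSequence} {f g : Icc (0 : ℝ) 1 → ℂ} (hf : Mem M f) (hg : Mem M g) :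
    Mem M (f + g) :=
  ⟨ContDiffOn.add hf.1 hg.1,
    (hf.2.add hg.2).of_nonneg_of_le (term_nonneg M _) (hf.add_le hg)⟩

theorem Mem.mul {M : WeightSequence} {f g : Icc (0 : ℝ) 1 → ℂ} (hf : Mem M f) (hg : Mem M g) :
    Mem M (f * g) :=
  ⟨ContDiffOn.mul hf.1 hg.1,
    (hasSum_sum_range_mul_of_summable_norm hf.2.norm hg.2.norm).summable.of_nonneg_of_le
      (term_nonneg M _) (supDeriv_mul_div_le M hf.1 hg.1)⟩

theorem Mem.dnorm_add_le {M : WeightSequence} {f g : Icc (0 : ℝ) 1 → ℂ} (hf : Mem M f)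
    (hg : Mem M g) : dnorm M (f + g) ≤ dnorm M f + dnorm M g :=
  ((hf.add hg).2.tsum_le_tsum (hf.add_le hg) (hf.2.add hg.2)).trans_eq (hf.2.tsum_add hg.2)

theorem Mem.dnorm_mul_le {M : WeightSequence} {f g : Icc (0 : ℝ) 1 → ℂ} (hf : Mem M f)
    (hg : Mem M g) : dnorm M (f * g) ≤ dnorm M f * dnorm M g := by
  have h := hasSum_sum_range_mul_of_summable_norm hf.2.norm hg.2.norm
  have h2 := (hf.mul hg).2.tsum_le_tsum (supDeriv_mul_div_le M hf.1 hg.1) h.summable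
  rw [h.tsum_eq] at h2
  exact h2

theorem dnorm_smul {M : WeightSequence} {f : Icc (0 : ℝ) 1 → ℂ} (hf : IsSmooth f) (c : ℂ) :
    dnorm M (c • f) = ‖c‖ * dnorm M f := by
  simp only [dnorm, supDeriv_smul hf, mul_div_assoc, tsum_mul_left]

theorem Mem.eq_zero {M : WeightSequence} {f : Icc (0 : ℝ) 1 → ℂ} (hf : Mem M f)
    (h : dnorm M f = 0) : f = 0 := by
  have h0 := hf.2.le_tsum 0 fun n _ => term_nonneg M f n
  rw [show (∑' n, supDeriv n f / M n) = 0 from h, M.zero_eq_one, div_one] at h0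
  funext x
  have hx := (hf.1.norm_le 0 x).trans h0
  have hd : deriv 0 f x = f x := by simp [deriv, extend]
  rwa [hd, norm_le_zero_iff] at hx

/-- `D([0,1], M)` as a subalgebra of the complex functions on `[0,1]`. -/
def subalgebra (M : WeightSequence) : Subalgebra ℂ (Icc (0 : ℝ) 1 → ℂ) where
  carrier := {f | Mem M f}
  mul_mem' := Mem.mul
  add_mem' := Mem.add
  algebraMap_mem' := mem_const M

end DSpace

/-- The algebra `D([0,1], M)`, with pointwise operations and the norm `‖·‖_D` (not the
topology of pointwise convergence). -/
def DSpace (M : WeightSequence) : Type := ↥(DSpace.subalgebra M)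

namespace DSpace

variable {M : WeightSequence}

instance : CommRing (DSpace M) := inferInstanceAs (CommRing ↥(DSpace.subalgebra M))

instance : Algebra ℂ (DSpace M) := inferInstanceAs (Algebra ℂ ↥(DSpace.subalgebra M))

instance : CoeFun (DSpace M) (fun _ => Icc (0 : ℝ) 1 → ℂ) := ⟨Subtype.val⟩

theorem mem (f : DSpace M) : Mem M f := Subtype.property f

/-- `‖·‖_D` as a norm on the additive group of `D([0,1], M)`. -/
def addGroupNorm (M : WeightSequence) : AddGroupNorm (DSpace M) where
  toFun f := dnorm M f
  map_zero' := by
    have h := (hasSum_const M 0).tsum_eq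
    rw [norm_zero] at h
    exact h
  add_le' f g := (mem f).dnorm_add_le (mem g)
  neg' f := by
    have h := dnorm_smul (M := M) (mem f).1 (-1)
    rw [norm_neg, norm_one, one_mul, neg_one_smul] at h
    exact h
  eq_zero_of_map_eq_zero' f h := Subtype.ext ((mem f).eq_zero h)

instance : NormedCommRing (DSpace M) where
  __ := (addGroupNorm M).toNormedAddCommGroup
  __ := (inferInstance : CommRing (DSpace M))
  norm_mul_le f g := (mem f).dnorm_mul_le (mem g)

instance : NormedAlgebra ℂ (DSpace M) where
  norm_smul_le c f := (dnorm_smul (mem f).1 c).le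

theorem norm_def (f : DSpace M) : ‖f‖ = ∑' n, (⨆ x, ‖deriv n f x‖) / M n := rfl

/-- The selfmap `φ` of `[0,1]` induces the endomorphism `T` of `D([0,1], M)`: `T f = f ∘ φ`. -/
def Induces (φ : Icc (0 : ℝ) 1 → Icc (0 : ℝ) 1) (T : DSpace M →ₐ[ℂ] DSpace M) : Prop :=
  ∀ (f : DSpace M) (x : Icc (0 : ℝ) 1), T f x = f (φ x)

end DSpace

end

/-!
Let `p` be a fixed point of `φ`. On the functions vanishing at `p` to order `k`, modulo those
vanishing to order `k + 1`, the operator `T` acts as the scalar `φ'(p) ^ k`. These subspaces are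
closed and strictly decreasing, so by Riesz's lemma compactness of `T` forces `φ'(p) ^ k → 0`:
every fixed point is attracting. The same holds for `φ ∘ φ`, which induces the compact operator
`T ∘ T`.

The immediate basin of `p` is an open interval, and `φ` maps its set of missing end points, at most
two of them, to itself. If this set were non-empty it would contain a fixed point of `φ ∘ φ`, whose
basin would be a neighbourhood of it and hence meet the basin of `p`, which is absurd. So all orbits
converge to `p`.

An eigenfunction `f` for `μ ≠ 0` satisfies `f (φ^[n] x) = μ ^ n * f x`, while `φ^[n] x → p`
geometrically near `p`. If `f` were flat at `p` it would therefore vanish near `p`, and then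
everywhere. Hence `f` has a finite order `k` at `p`, where `φ'(p) ^ k = μ`. As `|φ'(p)| < 1`, the
order `k` depends only on `μ`, so `f ↦ f⁽ᵏ⁾(p)` is injective on the eigenspace.
-/

open Filter Topology Asymptotics Function

section OrderConnected

variable {α : Type*} [LinearOrder α] [TopologicalSpace α] [OrderTopology α] {U J : Set α}
  {p x y : α}

theorem isOpen_ordConnectedComponent (hU : IsOpen U) : IsOpen (ordConnectedComponent U p) := by
  refine isOpen_iff_mem_nhds.2 fun x hx => ?_
  rw [ordConnectedComponent_eq hx, ordConnectedComponent_mem_nhds]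
  exact hU.mem_nhds (ordConnectedComponent_subset hx)

theorem mem_ordConnectedComponent_of_mem_closure (hU : IsOpen U) (hxU : x ∈ U)
    (hx : x ∈ closure (ordConnectedComponent U p)) : x ∈ ordConnectedComponent U p := by
  obtain ⟨y, hyx, hyp⟩ := mem_closure_iff_nhds.1 hx _
    (ordConnectedComponent_mem_nhds.2 (hU.mem_nhds hxU))
  exact mem_ordConnectedComponent_trans hyp (mem_ordConnectedComponent_comm.1 hyx)

theorem mem_of_lt_of_lt_of_mem_closure (hJ : J.OrdConnected) (hp : p ∈ J) (hpx : p < x)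
    (hxy : x < y) (hy : y ∈ closure J) : x ∈ J := by
  obtain ⟨z, hxz, hzJ⟩ := mem_closure_iff.1 hy _ isOpen_Ioi hxy
  exact hJ.out hp hzJ ⟨hpx.le, le_of_lt hxz⟩

theorem eq_of_mem_closure_diff (hJ : J.OrdConnected) (hp : p ∈ J)
    (hx : x ∈ closure J \ J) (hy : y ∈ closure J \ J) (hside : p < x ↔ p < y) : x = y := by
  by_contra hne
  wlog hxy : x < y generalizing x y
  · exact this hy hx hside.symm (Ne.symm hne) ((not_lt.1 hxy).lt_of_ne' hne)
  rcases lt_trichotomy p x with hpx | rfl | hxp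
  · exact hx.2 (mem_of_lt_of_lt_of_mem_closure hJ hp hpx hxy hy.1)
  · exact hx.2 hp
  · have hyp : y < p := (not_lt.1 (mt hside.2 hxp.not_gt)).lt_of_ne fun h => hy.2 (h ▸ hp)
    exact hy.2 (mem_of_lt_of_lt_of_mem_closure (α := αᵒᵈ) hJ.dual hp hyp hxy hx.1)

/-- Two of `x`, `φ x`, `φ (φ x)` lie on the same side of `p`, hence coincide. -/
theorem exists_isFixedPt_iterate_two {φ : α → α} (hJ : J.OrdConnected) (hp : p ∈ J)
    (hmaps : MapsTo φ (closure J \ J) (closure J \ J)) (hne : (closure J \ J).Nonempty) :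
    ∃ q ∈ closure J \ J, IsFixedPt φ^[2] q := by
  obtain ⟨x, hx⟩ := hne
  have hφx := hmaps hx
  have hφφx := hmaps hφx
  have hsides : (p < φ x ↔ p < x) ∨ (p < φ (φ x) ↔ p < φ x) ∨ (p < φ (φ x) ↔ p < x) := by
    tauto
  rcases hsides with h | h | h
  · have hfix : IsFixedPt φ x := eq_of_mem_closure_diff hJ hp hφx hx h
    exact ⟨x, hx, hfix.iterate 2⟩
  · have hfix : IsFixedPt φ (φ x) := eq_of_mem_closure_diff hJ hp hφφx hφx h
    exact ⟨φ x, hφx, hfix.iterate 2⟩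
  · exact ⟨x, hx, eq_of_mem_closure_diff hJ hp hφφx hx h⟩

end OrderConnected

section Basin

/-- The basin of attraction of `p` under iteration of `φ`. -/
def basin {α : Type*} [TopologicalSpace α] (φ : α → α) (p : α) : Set α :=
  {x | Tendsto (fun n => φ^[n] x) atTop (𝓝 p)}

variable {α : Type*} [TopologicalSpace α] {φ : α → α} {p q x : α}

theorem iterate_mem_basin_iff (m : ℕ) : φ^[m] x ∈ basin φ p ↔ x ∈ basin φ p := by
  simp only [basin, mem_ofPred_eq, ← iterate_add_apply]
  exact tendsto_add_atTop_iff_nat (f := fun n => φ^[n] x) m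

theorem basin_subset_basin_iterate {m : ℕ} (hm : 0 < m) : basin φ p ⊆ basin φ^[m] p :=
  fun x hx => by
    simp only [basin, mem_ofPred_eq, ← iterate_mul]
    exact Tendsto.comp hx (tendsto_id.const_mul_atTop' hm)

theorem eq_of_mem_basin [T2Space α] (hp : x ∈ basin φ p) (hq : x ∈ basin φ q) : p = q :=
  tendsto_nhds_unique hp hq

theorem isFixedPt_of_mem_basin [T2Space α] (hφ : Continuous φ) (hx : x ∈ basin φ p) :
    IsFixedPt φ p :=
  isFixedPt_of_tendsto_iterate hx hφ.continuousAt

theorem isOpen_basin (hφ : Continuous φ) (hp : basin φ p ∈ 𝓝 p) : IsOpen (basin φ p) := by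
  refine isOpen_iff_mem_nhds.2 fun x hx => ?_
  obtain ⟨m, hm⟩ := (Tendsto.eventually hx (eventually_mem_nhds_iff.2 hp)).exists
  filter_upwards [(hφ.iterate m).continuousAt.preimage_mem_nhds hm] with y hy
  exact (iterate_mem_basin_iff m).1 hy

end Basin

section IntervalDynamics

variable {α : Type*} [ConditionallyCompleteLinearOrder α] [DenselyOrdered α] [TopologicalSpace α]
  [OrderTopology α] {φ : α → α} {p : α}

theorem mapsTo_ordConnectedComponent {U : Set α} (hφ : Continuous φ) (hp : IsFixedPt φ p)
    (hU : MapsTo φ U U) :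
    MapsTo φ (ordConnectedComponent U p) (ordConnectedComponent U p) := fun x hx => by
  have hIVT : uIcc (φ p) (φ x) ⊆ φ '' uIcc p x := intermediate_value_uIcc hφ.continuousOn
  rw [hp] at hIVT
  exact hIVT.trans ((image_mono hx).trans hU.image_subset)

theorem mapsTo_closure_diff_ordConnectedComponent_basin (hφ : Continuous φ)
    (hp : basin φ p ∈ 𝓝 p) :
    MapsTo φ (closure (ordConnectedComponent (basin φ p) p) \ ordConnectedComponent (basin φ p) p)
      (closure (ordConnectedComponent (basin φ p) p) \ ordConnectedComponent (basin φ p) p) := by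
  have hmaps : MapsTo φ (ordConnectedComponent (basin φ p) p)
      (ordConnectedComponent (basin φ p) p) :=
    mapsTo_ordConnectedComponent hφ (isFixedPt_of_mem_basin hφ (mem_of_mem_nhds hp))
      fun _ => (iterate_mem_basin_iff 1).2
  refine fun x hx => ⟨hmaps.closure hφ hx.1, fun hφx => hx.2 ?_⟩
  exact mem_ordConnectedComponent_of_mem_closure (isOpen_basin hφ hp)
    ((iterate_mem_basin_iff 1).1 (ordConnectedComponent_subset hφx)) hx.1

theorem basin_eq_univ_of_forall_isFixedPt_iterate_two (hφ : Continuous φ) (hp : basin φ p ∈ 𝓝 p)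
    (hattr : ∀ q, IsFixedPt φ^[2] q → basin φ^[2] q ∈ 𝓝 q) : basin φ p = univ := by
  have hpU : p ∈ basin φ p := mem_of_mem_nhds hp
  have hmaps := mapsTo_closure_diff_ordConnectedComponent_basin hφ hp
  have hopen : IsOpen (ordConnectedComponent (basin φ p) p) :=
    isOpen_ordConnectedComponent (isOpen_basin hφ hp)
  set J := ordConnectedComponent (basin φ p) p
  have hpJ : p ∈ J := self_mem_ordConnectedComponent.2 hpU
  have hempty : closure J \ J = ∅ := by
    by_contra hne
    obtain ⟨q, hq, hqfix⟩ := exists_isFixedPt_iterate_two inferInstance hpJ hmaps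
      (nonempty_iff_ne_empty.2 hne)
    obtain ⟨y, hyq, hyJ⟩ := mem_closure_iff_nhds.1 hq.1 _ (hattr q hqfix)
    have hyp : y ∈ basin φ^[2] p :=
      basin_subset_basin_iterate two_pos (ordConnectedComponent_subset hyJ)
    exact hq.2 (eq_of_mem_basin hyp hyq ▸ hpJ)
  have hclopen : IsClopen J :=
    ⟨closure_subset_iff_isClosed.1 (sdiff_eq_empty.1 hempty), hopen⟩
  exact univ_subset_iff.1 (hclopen.eq_univ ⟨p, hpJ⟩ ▸ ordConnectedComponent_subset)

end IntervalDynamics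

section Contraction

variable {α : Type*} [PseudoMetricSpace α] {φ : α → α} {p : α} {r : ℝ}

theorem eventually_dist_iterate_le (hr0 : 0 ≤ r) (hr1 : r ≤ 1)
    (h : ∀ᶠ x in 𝓝 p, dist (φ x) p ≤ r * dist x p) :
    ∀ᶠ x in 𝓝 p, ∀ n, dist (φ^[n] x) p ≤ r ^ n * dist x p := by
  obtain ⟨ε, hε, hball⟩ := Metric.eventually_nhds_iff_ball.1 h
  filter_upwards [Metric.ball_mem_nhds p hε] with x hx n
  induction n with
  | zero => simp
  | succ n ih =>
    have hle : r ^ n * dist x p ≤ dist x p :=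
      mul_le_of_le_one_left dist_nonneg (pow_le_one₀ hr0 hr1)
    have hmem : φ^[n] x ∈ Metric.ball p ε := (ih.trans hle).trans_lt hx
    calc dist (φ^[n + 1] x) p = dist (φ (φ^[n] x)) p := by rw [iterate_succ_apply']
      _ ≤ r * dist (φ^[n] x) p := hball _ hmem
      _ ≤ r * (r ^ n * dist x p) := by gcongr
      _ = r ^ (n + 1) * dist x p := by ring

theorem basin_mem_nhds_of_dist_le (hr0 : 0 ≤ r) (hr1 : r < 1)
    (h : ∀ᶠ x in 𝓝 p, dist (φ x) p ≤ r * dist x p) : basin φ p ∈ 𝓝 p := by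
  filter_upwards [eventually_dist_iterate_le hr0 hr1.le h] with x hx
  refine tendsto_iff_dist_tendsto_zero.2 (squeeze_zero (fun _ => dist_nonneg) hx ?_)
  simpa using (tendsto_pow_atTop_nhds_zero_of_lt_one hr0 hr1).mul_const (dist x p)

end Contraction

section Compact

variable {𝕜 E : Type*} [NontriviallyNormedField 𝕜] [NormedAddCommGroup E] [NormedSpace 𝕜 E]

variable (𝕜 E) in
theorem exists_forall_one_le_norm_sub :
    ∃ R : ℝ, ∀ V W : Submodule 𝕜 E, IsClosed (V : Set E) → V < W →
      ∃ f ∈ W, ‖f‖ ≤ R ∧ ∀ g ∈ V, 1 ≤ ‖f - g‖ := by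
  obtain ⟨a, ha⟩ := NormedField.exists_one_lt_norm 𝕜
  refine ⟨‖a‖ + 1, fun V W hcl hVW => ?_⟩
  obtain ⟨w, hwW, hwV⟩ := SetLike.exists_of_lt hVW
  obtain ⟨f, hfR, hf⟩ := riesz_lemma_of_norm_lt ha (lt_add_one _)
    (F := V.comap W.subtype) (hcl.preimage continuous_subtype_val) ⟨⟨w, hwW⟩, hwV⟩
  exact ⟨f, f.2, hfR, fun g hg => hf ⟨g, hVW.le hg⟩ hg⟩

theorem norm_le_norm_smul_sub {V : Submodule 𝕜 E} {f w : E} (hf : ∀ g ∈ V, 1 ≤ ‖f - g‖)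
    (hw : w ∈ V) (c : 𝕜) : ‖c‖ ≤ ‖c • f - w‖ := by
  rcases eq_or_ne c 0 with rfl | hc
  · simp
  · have h := hf (c⁻¹ • w) (V.smul_mem _ hw)
    calc ‖c‖ ≤ ‖c‖ * ‖f - c⁻¹ • w‖ := le_mul_of_one_le_right (norm_nonneg c) h
      _ = ‖c • f - w‖ := by rw [← norm_smul, smul_sub, smul_inv_smul₀ hc]

theorem exists_dist_lt_of_isCompactOperator {T : E →ₗ[𝕜] E} (hT : IsCompactOperator T) {R : ℝ}
    {f : ℕ → E} (hf : ∀ k, ‖f k‖ ≤ R) {ε : ℝ} (hε : 0 < ε) :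
    ∃ k m, k < m ∧ dist (T (f k)) (T (f m)) < ε := by
  obtain ⟨K, hK, hTK⟩ := IsCompactOperator.image_closedBall_subset_compact (f := T) hT R
  obtain ⟨g, -, σ, hσ, hg⟩ := hK.tendsto_subseq (x := fun k => T (f k))
    fun k => hTK ⟨f k, mem_closedBall_zero_iff.2 (hf k), rfl⟩
  obtain ⟨N, hN⟩ := Metric.cauchySeq_iff'.1 hg.cauchySeq ε hε
  exact ⟨σ N, σ (N + 1), hσ N.lt_succ_self, by simpa [dist_comm] using hN (N + 1) N.le_succ⟩

/-- `T` acts on the quotient `V k / V (k + 1)` as the scalar `c k`. -/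
theorem tendsto_zero_of_isCompactOperator {T : E →ₗ[𝕜] E} (hT : IsCompactOperator T)
    {V : ℕ → Submodule 𝕜 E} (hV : StrictAnti V) (hcl : ∀ k, IsClosed (V k : Set E)) {c : ℕ → 𝕜}
    (hc : ∀ k, ∀ f ∈ V k, T f - c k • f ∈ V (k + 1)) : Tendsto c atTop (𝓝 0) := by
  rw [NormedAddGroup.tendsto_nhds_zero]
  by_contra! h
  obtain ⟨ε, hε, hfreq⟩ := h
  obtain ⟨σ, hσ, hcσ⟩ := extraction_of_frequently_atTop hfreq
  obtain ⟨R, hR⟩ := exists_forall_one_le_norm_sub 𝕜 E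
  choose f hfV hfR hf using fun k => hR _ _ (hcl (k + 1)) (hV k.lt_succ_self)
  obtain ⟨k, m, hkm, hlt⟩ :=
    exists_dist_lt_of_isCompactOperator hT (fun k => hfR (σ k)) hε
  have hTfm : T (f (σ m)) ∈ V (σ k + 1) := by
    refine hV.antitone (hσ hkm) (((V (σ m)).sub_mem_iff_left ?_).1
      (hV.antitone (σ m).le_succ (hc _ _ (hfV (σ m)))))
    exact Submodule.smul_mem _ (c (σ m)) (hfV (σ m))
  have hle : ‖c (σ k)‖ ≤ dist (T (f (σ k))) (T (f (σ m))) :=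
    calc ‖c (σ k)‖
        ≤ ‖c (σ k) • f (σ k) - (T (f (σ m)) - (T (f (σ k)) - c (σ k) • f (σ k)))‖ :=
          norm_le_norm_smul_sub (hf (σ k)) (sub_mem hTfm (hc _ _ (hfV (σ k)))) _
      _ = dist (T (f (σ k))) (T (f (σ m))) := by rw [dist_eq_norm]; congr 1; abel
  exact ((hcσ k).trans hle).not_gt hlt

end Compact

theorem eq_of_pow_eq_pow_of_norm_lt_one {𝕜 : Type*} [NormedDivisionRing 𝕜] {a : 𝕜} {k l : ℕ}
    (ha : ‖a‖ < 1) (h : a ^ k = a ^ l) (hk : a ^ k ≠ 0) : k = l := by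
  rcases eq_or_ne a 0 with rfl | ha0
  · have hzero {n : ℕ} (hn : (0 : 𝕜) ^ n ≠ 0) : n = 0 := not_ne_iff.1 (mt zero_pow hn)
    exact (hzero hk).trans (hzero (h.symm.trans_ne hk)).symm
  · refine pow_right_injective₀ (norm_pos_iff.2 ha0) ha.ne ?_
    simpa only [norm_pow] using congrArg norm h

namespace DSpace

variable {M : WeightSequence} {p : Icc (0 : ℝ) 1}

section Coordinate

theorem mem_coord (M : WeightSequence) : Mem M fun x => ((x : ℝ) : ℂ) := by
  have hs : EqOn (extend fun x => ((x : ℝ) : ℂ)) (fun x : ℝ => (x : ℂ)) (Icc 0 1) :=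
    fun x hx => by simp only [extend, IccExtend_of_mem _ _ hx]
  have hderiv : EqOn (derivWithin (fun x : ℝ => (x : ℂ)) (Icc 0 1)) (fun _ => 1) (Icc 0 1) :=
    fun y hy => Complex.ofRealCLM.hasDerivWithinAt.derivWithin (uniqueDiff y hy)
  have hzero : ∀ n x, deriv (n + 2) (fun x => ((x : ℝ) : ℂ)) x = 0 := fun n x => by
    rw [deriv, iteratedDerivWithin_congr hs x.2, iteratedDerivWithin_succ',
      iteratedDerivWithin_congr hderiv x.2, iteratedDerivWithin_const, if_neg n.succ_ne_zero]
  refine ⟨Complex.ofRealCLM.contDiff.contDiffOn.congr hs, (summable_nat_add_iff 2).1 ?_⟩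
  simpa only [supDeriv, hzero, norm_zero, ciSup_const, zero_div] using summable_zero

/-- The function `x ↦ x - p` as an element of `D([0,1], M)`. -/
noncomputable def localCoord (M : WeightSequence) (p : Icc (0 : ℝ) 1) : DSpace M :=
  ⟨fun x => ((x : ℝ) : ℂ), mem_coord M⟩ - algebraMap ℂ (DSpace M) (p : ℝ)

theorem localCoord_apply (x : Icc (0 : ℝ) 1) : localCoord M p x = (x : ℝ) - (p : ℝ) := rfl

theorem norm_localCoord_apply (x : Icc (0 : ℝ) 1) : ‖localCoord M p x‖ = dist x p := by
  rw [localCoord_apply, ← Complex.ofReal_sub, Complex.norm_real, Subtype.dist_eq, Real.dist_eq,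
    Real.norm_eq_abs]

end Coordinate

section Derivative

theorem norm_deriv_le (k : ℕ) (p : Icc (0 : ℝ) 1) (f : DSpace M) :
    ‖deriv k f p‖ ≤ M k * ‖f‖ := by
  have hterm : supDeriv k f / M k ≤ ‖f‖ := (mem f).2.le_tsum k fun n _ => term_nonneg M f n
  exact ((mem f).1.norm_le k p).trans ((div_le_iff₀' (M.pos k)).1 hterm)

/-- The functional `f ↦ f⁽ᵏ⁾(p)` on `D([0,1], M)`. -/
noncomputable def derivCLM (M : WeightSequence) (k : ℕ) (p : Icc (0 : ℝ) 1) : DSpace M →L[ℂ] ℂ :=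
  LinearMap.mkContinuous
    { toFun := fun f => deriv k f p
      map_add' := fun f g => deriv_add (mem f).1 (mem g).1 k p
      map_smul' := fun c f => deriv_smul (mem f).1 c k p } (M k) (norm_deriv_le k p)

theorem derivCLM_apply (k : ℕ) (f : DSpace M) : derivCLM M k p f = deriv k f p := rfl

theorem deriv_zero_apply (f : DSpace M) (x : Icc (0 : ℝ) 1) : deriv 0 f x = f x := by
  simp only [deriv, extend, iteratedDerivWithin_zero, IccExtend_val]

protected theorem continuous (f : DSpace M) : Continuous f := by
  have h : Continuous fun x : Icc (0 : ℝ) 1 => extend f x :=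
    continuousOn_iff_continuous_domRestrict.1 (mem f).1.continuousOn
  simpa only [extend, IccExtend_val] using h

end Derivative

section Vanishing

/-- The functions in `D([0,1], M)` vanishing at `p` to order at least `k`, that is, those of size
`O(|x - p| ^ k)` near `p`. -/
def vanishing (M : WeightSequence) (p : Icc (0 : ℝ) 1) (k : ℕ) : Submodule ℂ (DSpace M) where
  carrier := {f | (f : Icc (0 : ℝ) 1 → ℂ) =O[𝓝 p] fun x => dist x p ^ k}
  add_mem' := IsBigO.add
  zero_mem' := isBigO_zero _ _
  smul_mem' c _ hf := hf.const_smul_left c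

variable {j k : ℕ} {f g : DSpace M}

theorem mem_vanishing : f ∈ vanishing M p k ↔ f =O[𝓝 p] fun x => dist x p ^ k := Iff.rfl

theorem tendsto_dist_self : Tendsto (fun x => dist x p) (𝓝 p) (𝓝 0) :=
  tendsto_iff_dist_tendsto_zero.1 tendsto_id

theorem isLittleO_dist_pow (h : j < k) :
    (fun x => dist x p ^ k) =o[𝓝 p] fun x => dist x p ^ j :=
  (isLittleO_pow_pow h).comp_tendsto tendsto_dist_self

theorem antitone_vanishing : Antitone (vanishing M p) := by
  refine antitone_nat_of_succ_le fun k f hf => ?_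
  exact IsBigO.trans hf (isLittleO_dist_pow k.lt_succ_self).isBigO

theorem mem_vanishing_zero : f ∈ vanishing M p 0 := by
  rw [mem_vanishing]
  simpa only [pow_zero] using (f.continuous.tendsto p).isBigO_one ℝ

theorem mul_mem_vanishing (hf : f ∈ vanishing M p j) (hg : g ∈ vanishing M p k) :
    f * g ∈ vanishing M p (j + k) :=
  (IsBigO.mul hf hg).congr_right fun _ => (pow_add _ _ _).symm

theorem pow_mem_vanishing (hf : f ∈ vanishing M p 1) (k : ℕ) : f ^ k ∈ vanishing M p k := by
  induction k with
  | zero => exact mem_vanishing_zero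
  | succ k ih => exact pow_succ f k ▸ mul_mem_vanishing ih hf

theorem localCoord_mem_vanishing : localCoord M p ∈ vanishing M p 1 :=
  IsBigO.of_norm_eventuallyLE <| .of_forall fun x => by
    simp only [norm_localCoord_apply, pow_one, le_refl]

theorem localCoord_pow_notMem_vanishing : localCoord M p ^ k ∉ vanishing M p (k + 1) := by
  intro h
  have hO : (fun x => dist x p ^ k) =O[𝓝 p] fun x => dist x p ^ (k + 1) :=
    (mem_vanishing.1 h).norm_left.congr_left fun x => by
      rw [← norm_localCoord_apply (M := M), ← norm_pow]
      rfl
  have hself : (fun x => dist x p ^ k) =o[𝓝[≠] p] fun x => dist x p ^ k :=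
    (hO.trans_isLittleO (isLittleO_dist_pow k.lt_succ_self)).mono nhdsWithin_le_nhds
  refine isLittleO_irrefl' (Eventually.frequently ?_) hself
  filter_upwards [self_mem_nhdsWithin] with x hx
  exact norm_ne_zero_iff.2 (pow_ne_zero k (dist_ne_zero.2 hx))

theorem smul_localCoord_pow_mem_vanishing_iff {a : ℂ} :
    a • localCoord M p ^ k ∈ vanishing M p (k + 1) ↔ a = 0 := by
  refine ⟨fun h => ?_, fun h => by simp only [h, zero_smul, zero_mem]⟩
  by_contra ha
  exact localCoord_pow_notMem_vanishing (((vanishing M p _).smul_mem_iff ha).1 h)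

end Vanishing

section Taylor

variable {k : ℕ} {f : DSpace M}

theorem sum_apply {ι : Type*} (s : Finset ι) (f : ι → DSpace M) (x : Icc (0 : ℝ) 1) :
    (∑ i ∈ s, f i) x = ∑ i ∈ s, f i x :=
  map_sum ((Pi.evalAlgHom ℂ _ x).comp (subalgebra M).val) f s

theorem sub_taylor_mem_vanishing (f : DSpace M) (p : Icc (0 : ℝ) 1) (k : ℕ) :
    f - ∑ j ∈ Finset.range k, (deriv j f p / j.factorial) • localCoord M p ^ j ∈
      vanishing M p k := by
  have htaylor := taylor_isLittleO (n := k) (convex_Icc (0 : ℝ) 1) p.2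
    ((mem f).1.of_le (by exact_mod_cast le_top))
  have hval : Tendsto ((↑) : Icc (0 : ℝ) 1 → ℝ) (𝓝 p) (𝓝[Icc 0 1] p) := by
    rw [nhds_subtype_eq_comap_nhdsWithin]
    exact tendsto_comap
  have hsucc : f - ∑ j ∈ Finset.range (k + 1), (deriv j f p / j.factorial) • localCoord M p ^ j ∈
      vanishing M p k := by
    refine (((htaylor.comp_tendsto hval).isBigO.congr_left fun x => ?_).trans
      (isBigO_of_le _ fun x => ?_))
    · rw [Function.comp_apply, taylor_within_apply]
      change _ = f x - _
      rw [sum_apply]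
      congr 1
      · simp only [extend, IccExtend_val]
      · refine Finset.sum_congr rfl fun j _ => ?_
        change _ = (deriv j f p / j.factorial) * localCoord M p x ^ j
        rw [Complex.real_smul, localCoord_apply, deriv]
        push_cast
        ring
    · simp [Subtype.dist_eq, Real.dist_eq]
  rw [Finset.sum_range_succ, ← sub_sub] at hsucc
  refine ((vanishing M p k).sub_mem_iff_left ?_).1 hsucc
  exact (vanishing M p k).smul_mem _ (pow_mem_vanishing localCoord_mem_vanishing k)

theorem sub_smul_localCoord_pow_mem_vanishing_of_deriv (hf : ∀ j < k, deriv j f p = 0) :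
    f - (deriv k f p / k.factorial) • localCoord M p ^ k ∈ vanishing M p (k + 1) := by
  have hlow : ∑ j ∈ Finset.range k, (deriv j f p / j.factorial) • localCoord M p ^ j = 0 :=
    Finset.sum_eq_zero fun j hj => by rw [hf j (Finset.mem_range.1 hj), zero_div, zero_smul]
  simpa only [Finset.sum_range_succ, hlow, zero_add] using sub_taylor_mem_vanishing f p (k + 1)

theorem mem_vanishing_iff_deriv : f ∈ vanishing M p k ↔ ∀ j < k, deriv j f p = 0 := by
  induction k with
  | zero => exact iff_of_true mem_vanishing_zero fun j hj => absurd hj j.not_lt_zero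
  | succ k ih =>
    rw [Nat.forall_lt_succ_right, ← ih]
    have hsucc (hf : f ∈ vanishing M p k) : f ∈ vanishing M p (k + 1) ↔ deriv k f p = 0 := by
      have h := sub_smul_localCoord_pow_mem_vanishing_of_deriv (ih.1 hf)
      rw [← (vanishing M p (k + 1)).sub_mem_iff_right h, sub_sub_cancel_left, neg_mem_iff,
        smul_localCoord_pow_mem_vanishing_iff, div_eq_zero_iff,
        or_iff_left (Nat.cast_ne_zero.2 k.factorial_ne_zero)]
    refine ⟨fun hf => ?_, fun hf => (hsucc hf.1).2 hf.2⟩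
    have hfk := antitone_vanishing k.le_succ hf
    exact ⟨hfk, (hsucc hfk).1 hf⟩

theorem sub_smul_localCoord_pow_mem_vanishing (hf : f ∈ vanishing M p k) :
    f - (deriv k f p / k.factorial) • localCoord M p ^ k ∈ vanishing M p (k + 1) :=
  sub_smul_localCoord_pow_mem_vanishing_of_deriv (mem_vanishing_iff_deriv.1 hf)

theorem isClosed_vanishing (M : WeightSequence) (p : Icc (0 : ℝ) 1) (k : ℕ) :
    IsClosed (vanishing M p k : Set (DSpace M)) := by
  have h : (vanishing M p k : Set (DSpace M)) = ⋂ j < k, derivCLM M j p ⁻¹' {0} := by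
    ext f
    simp only [SetLike.mem_coe, mem_vanishing_iff_deriv, mem_iInter, mem_preimage,
      mem_singleton_iff, derivCLM_apply]
  rw [h]
  exact isClosed_biInter fun j _ => isClosed_singleton.preimage (derivCLM M j p).continuous

theorem strictAnti_vanishing (M : WeightSequence) (p : Icc (0 : ℝ) 1) :
    StrictAnti (vanishing M p) :=
  strictAnti_nat_of_succ_lt fun k => SetLike.lt_iff_le_and_exists.2 ⟨antitone_vanishing k.le_succ,
    _, pow_mem_vanishing localCoord_mem_vanishing k, localCoord_pow_notMem_vanishing⟩

end Taylor

section Endomorphism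

variable {φ : Icc (0 : ℝ) 1 → Icc (0 : ℝ) 1} {T : DSpace M →ₐ[ℂ] DSpace M} {k : ℕ}
  {f g : DSpace M}

theorem Induces.iterate_two (hT : Induces φ T) : Induces φ^[2] (T.comp T) := fun f x =>
  (hT (T f) x).trans (hT f (φ x))

theorem Induces.continuous (hT : Induces φ T) : Continuous φ := by
  have h : Continuous fun x => localCoord M 0 (φ x) :=
    (T (localCoord M 0)).continuous.congr (hT _)
  simp only [localCoord_apply] at h
  exact continuous_induced_rng.2 ((Complex.continuous_re.comp h).congr fun x => by simp)

theorem pow_sub_pow_mem_vanishing (hf : f ∈ vanishing M p 1) (hg : g ∈ vanishing M p 1)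
    (hfg : f - g ∈ vanishing M p 2) (k : ℕ) : f ^ k - g ^ k ∈ vanishing M p (k + 1) := by
  induction k with
  | zero => simp only [pow_zero, sub_self, zero_mem]
  | succ k ih =>
    have h : f ^ (k + 1) - g ^ (k + 1) = (f ^ k - g ^ k) * f + g ^ k * (f - g) := by ring
    rw [h]
    have hmul : g ^ k * (f - g) ∈ vanishing M p (k + 2) :=
      mul_mem_vanishing (pow_mem_vanishing hg k) hfg
    exact add_mem (mul_mem_vanishing ih hf) hmul

/-- The derivative at a fixed point `p` of the selfmap inducing `T`. -/
noncomputable def multiplier (T : DSpace M →ₐ[ℂ] DSpace M) (p : Icc (0 : ℝ) 1) : ℂ :=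
  deriv 1 (T (localCoord M p)) p

theorem Induces.apply_localCoord_mem_vanishing (hT : Induces φ T) (hp : IsFixedPt φ p) :
    T (localCoord M p) ∈ vanishing M p 1 := by
  refine mem_vanishing_iff_deriv.2 fun j hj => ?_
  rw [Nat.lt_one_iff.1 hj, deriv_zero_apply, hT, hp, localCoord_apply, sub_self]

theorem Induces.apply_localCoord_sub_mem_vanishing (hT : Induces φ T) (hp : IsFixedPt φ p) :
    T (localCoord M p) - multiplier T p • localCoord M p ∈ vanishing M p 2 := by
  simpa only [multiplier, Nat.factorial_one, Nat.cast_one, div_one, pow_one] using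
    sub_smul_localCoord_pow_mem_vanishing (hT.apply_localCoord_mem_vanishing hp)

theorem Induces.apply_mem_vanishing (hT : Induces φ T) (hp : IsFixedPt φ p)
    (hf : f ∈ vanishing M p k) : T f ∈ vanishing M p k := by
  have hφ : Tendsto φ (𝓝 p) (𝓝 p) := by simpa only [hp.eq] using hT.continuous.tendsto p
  have hdist : (fun x => dist (φ x) p) =O[𝓝 p] fun x => dist x p :=
    (mem_vanishing.1 (hT.apply_localCoord_mem_vanishing hp)).norm_left.congr
      (fun x => by rw [hT, norm_localCoord_apply]) fun _ => pow_one _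
  exact ((IsBigO.comp_tendsto hf hφ).trans (hdist.pow k)).congr_left fun x => (hT f x).symm

theorem Induces.apply_sub_mem_vanishing (hT : Induces φ T) (hp : IsFixedPt φ p)
    (hf : f ∈ vanishing M p k) : T f - multiplier T p ^ k • f ∈ vanishing M p (k + 1) := by
  set c := multiplier T p
  set z := localCoord M p
  obtain ⟨a, h, hh, rfl⟩ : ∃ a : ℂ, ∃ h ∈ vanishing M p (k + 1), f = a • z ^ k + h :=
    ⟨_, _, sub_smul_localCoord_pow_mem_vanishing hf, (add_sub_cancel _ _).symm⟩
  have hpow : T z ^ k - (c • z) ^ k ∈ vanishing M p (k + 1) :=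
    pow_sub_pow_mem_vanishing (hT.apply_localCoord_mem_vanishing hp)
      (Submodule.smul_mem _ c localCoord_mem_vanishing) (hT.apply_localCoord_sub_mem_vanishing hp) k
  have hsplit : T (a • z ^ k + h) - c ^ k • (a • z ^ k + h) =
      a • (T z ^ k - (c • z) ^ k) + (T h - c ^ k • h) := by
    rw [map_add, map_smul, map_pow, smul_pow]
    module
  rw [hsplit]
  exact add_mem (Submodule.smul_mem _ a hpow)
    (sub_mem (hT.apply_mem_vanishing hp hh) (Submodule.smul_mem _ _ hh))

theorem Induces.norm_multiplier_lt_one (hT : Induces φ T) (hc : IsCompactOperator T)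
    (hp : IsFixedPt φ p) : ‖multiplier T p‖ < 1 :=
  tendsto_pow_atTop_nhds_zero_iff_norm_lt_one.1 <|
    tendsto_zero_of_isCompactOperator (T := T.toLinearMap) hc (strictAnti_vanishing M p)
      (isClosed_vanishing M p) fun _ _ hf => hT.apply_sub_mem_vanishing hp hf

theorem Induces.exists_eventually_dist_le (hT : Induces φ T) (hc : IsCompactOperator T)
    (hp : IsFixedPt φ p) :
    ∃ r : ℝ, 0 ≤ r ∧ r < 1 ∧ ∀ᶠ x in 𝓝 p, dist (φ x) p ≤ r * dist x p := by
  have hlt := hT.norm_multiplier_lt_one hc hp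
  set c := multiplier T p
  have hlin : (T (localCoord M p) - c • localCoord M p) =o[𝓝 p] fun x => dist x p ^ 1 :=
    (mem_vanishing.1 (hT.apply_localCoord_sub_mem_vanishing hp)).trans_isLittleO
      (isLittleO_dist_pow one_lt_two)
  refine ⟨(1 + ‖c‖) / 2, by positivity, by linarith, ?_⟩
  filter_upwards [hlin.bound (show 0 < (1 - ‖c‖) / 2 by linarith)] with x hx
  calc dist (φ x) p = ‖T (localCoord M p) x‖ := by rw [hT, norm_localCoord_apply]
    _ = ‖(T (localCoord M p) - c • localCoord M p) x + c * localCoord M p x‖ :=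
      congrArg norm (sub_add_cancel _ _).symm
    _ ≤ ‖(T (localCoord M p) - c • localCoord M p) x‖ + ‖c * localCoord M p x‖ := norm_add_le _ _
    _ ≤ (1 - ‖c‖) / 2 * dist x p + ‖c‖ * dist x p := by
      rw [norm_mul, norm_localCoord_apply]
      rw [pow_one, Real.norm_of_nonneg dist_nonneg] at hx
      gcongr
    _ = (1 + ‖c‖) / 2 * dist x p := by ring

end Endomorphism

section Eigenfunction

variable {φ : Icc (0 : ℝ) 1 → Icc (0 : ℝ) 1} {T : DSpace M →ₐ[ℂ] DSpace M} {μ : ℂ} {k : ℕ}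
  {f : DSpace M}

theorem Induces.basin_mem_nhds (hT : Induces φ T) (hc : IsCompactOperator T)
    (hp : IsFixedPt φ p) : basin φ p ∈ 𝓝 p := by
  obtain ⟨r, hr0, hr1, h⟩ := hT.exists_eventually_dist_le hc hp
  exact basin_mem_nhds_of_dist_le hr0 hr1 h

theorem Induces.basin_eq_univ (hT : Induces φ T) (hc : IsCompactOperator T)
    (hp : IsFixedPt φ p) : basin φ p = univ := by
  have hcont : Continuous T := IsCompactOperator.continuous (f := T.toLinearMap) hc
  have hc2 : IsCompactOperator (T.comp T) := hc.continuous_comp hcont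
  exact basin_eq_univ_of_forall_isFixedPt_iterate_two hT.continuous
    (hT.basin_mem_nhds hc hp) fun q hq => hT.iterate_two.basin_mem_nhds hc2 hq

theorem Induces.apply_iterate (hT : Induces φ T) (hf : T f = μ • f) (n : ℕ)
    (x : Icc (0 : ℝ) 1) : f (φ^[n] x) = μ ^ n * f x := by
  induction n with
  | zero => simp only [iterate_zero_apply, pow_zero, one_mul]
  | succ n ih =>
    calc f (φ^[n + 1] x) = T f (φ^[n] x) := by rw [iterate_succ_apply', hT]
      _ = μ * f (φ^[n] x) := by rw [hf]; rfl
      _ = μ ^ (n + 1) * f x := by rw [ih, pow_succ', mul_assoc]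

/-- Near `p`, `f (φ^[n] x) = μ ^ n * f x` while `|f (φ^[n] x)| ≤ C (r ^ n) ^ N`; take
`r ^ N < |μ|`. -/
theorem Induces.eventually_apply_eq_zero (hT : Induces φ T) (hc : IsCompactOperator T)
    (hp : IsFixedPt φ p) (hμ : μ ≠ 0) (hf : T f = μ • f) (hflat : ∀ k, f ∈ vanishing M p k) :
    ∀ᶠ x in 𝓝 p, f x = 0 := by
  obtain ⟨r, hr0, hr1, hr⟩ := hT.exists_eventually_dist_le hc hp
  obtain ⟨N, hN⟩ := exists_pow_lt_of_lt_one (norm_pos_iff.2 hμ) hr1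
  filter_upwards [eventually_dist_iterate_le hr0 hr1.le hr, hT.basin_mem_nhds hc hp] with x hx hxp
  have horbit : (fun n => dist (φ^[n] x) p) =O[atTop] fun n => r ^ n :=
    .of_bound (dist x p) <| .of_forall fun n => by
      rw [Real.norm_of_nonneg dist_nonneg, Real.norm_of_nonneg (pow_nonneg hr0 n), mul_comm]
      exact hx n
  have hlittle : (fun n => f x * μ ^ n) =o[atTop] fun n => μ ^ n :=
    calc (fun n => f x * μ ^ n) = fun n => f (φ^[n] x) :=
          funext fun n => by rw [hT.apply_iterate hf, mul_comm]
      _ =O[atTop] fun n => dist (φ^[n] x) p ^ N := (mem_vanishing.1 (hflat N)).comp_tendsto hxp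
      _ =O[atTop] fun n => (r ^ n) ^ N := horbit.pow N
      _ = fun n => (r ^ N) ^ n := funext fun n => pow_right_comm r n N
      _ =o[atTop] fun n => ‖μ‖ ^ n := isLittleO_pow_pow_of_lt_left (pow_nonneg hr0 N) hN
      _ =O[atTop] fun n => μ ^ n := (isBigO_refl _ _).norm_left.congr_left (norm_pow μ)
  by_contra hfx
  exact isLittleO_irrefl (.of_forall fun n => pow_ne_zero n hμ)
    ((isLittleO_const_mul_left_iff hfx).1 hlittle)

theorem Induces.eq_zero_of_forall_mem_vanishing (hT : Induces φ T) (hc : IsCompactOperator T)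
    (hp : IsFixedPt φ p) (hμ : μ ≠ 0) (hf : T f = μ • f) (hflat : ∀ k, f ∈ vanishing M p k) :
    f = 0 := by
  refine Subtype.ext (funext fun x => ?_)
  have hx : Tendsto (fun n => φ^[n] x) atTop (𝓝 p) :=
    eq_univ_iff_forall.1 (hT.basin_eq_univ hc hp) x
  obtain ⟨n, hn⟩ := (hx.eventually (hT.eventually_apply_eq_zero hc hp hμ hf hflat)).exists
  rw [hT.apply_iterate hf] at hn
  exact (mul_eq_zero.1 hn).resolve_left (pow_ne_zero n hμ)

theorem Induces.exists_order (hT : Induces φ T) (hc : IsCompactOperator T)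
    (hp : IsFixedPt φ p) (hμ : μ ≠ 0) (hf : T f = μ • f) (hf0 : f ≠ 0) :
    ∃ k, deriv k f p ≠ 0 ∧ multiplier T p ^ k = μ := by
  obtain ⟨k, hk, hk'⟩ : ∃ k, f ∈ vanishing M p k ∧ f ∉ vanishing M p (k + 1) := by
    by_contra! h
    exact hf0 <| hT.eq_zero_of_forall_mem_vanishing hc hp hμ hf fun k =>
      Nat.rec mem_vanishing_zero h k
  have hdiff : (μ - multiplier T p ^ k) • f ∈ vanishing M p (k + 1) := by
    rw [sub_smul, ← hf]
    exact hT.apply_sub_mem_vanishing hp hk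
  refine ⟨k, fun h => hk' (mem_vanishing_iff_deriv.2 ?_), ?_⟩
  · exact Nat.forall_lt_succ_right.2 ⟨mem_vanishing_iff_deriv.1 hk, h⟩
  · by_contra hne
    exact hk' <| (Submodule.smul_mem_iff _ (sub_ne_zero.2 (Ne.symm hne))).1 hdiff

theorem Induces.deriv_ne_zero (hT : Induces φ T) (hc : IsCompactOperator T)
    (hp : IsFixedPt φ p) (hμ : μ ≠ 0) (hk : multiplier T p ^ k = μ) (hf : T f = μ • f)
    (hf0 : f ≠ 0) : deriv k f p ≠ 0 := by
  obtain ⟨l, hfl, hl⟩ := hT.exists_order hc hp hμ hf hf0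
  have hkl : k = l := eq_of_pow_eq_pow_of_norm_lt_one (hT.norm_multiplier_lt_one hc hp)
    (hk.trans hl.symm) (hk.trans_ne hμ)
  exact hkl ▸ hfl

end Eigenfunction

end DSpace

theorem theorem2p5 (M : WeightSequence) (φ : Set.Icc (0 : ℝ) 1 → Set.Icc (0 : ℝ) 1)
    (T : DSpace M →ₐ[ℂ] DSpace M) (hT : DSpace.Induces φ T) (hc : IsCompactOperator T)
    (μ : ℂ) (hμ : μ ≠ 0) (hev : Module.End.HasEigenvalue T.toLinearMap μ) :
    Module.finrank ℂ (Module.End.eigenspace T.toLinearMap μ) = 1 := by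
  obtain ⟨p, hp⟩ : ∃ p, IsFixedPt φ p :=
    intermediate_value_univ₂ (a := 1) (b := 0) hT.continuous continuous_id (φ 1).2.2 (φ 0).2.1
  obtain ⟨f, hf⟩ := hev.exists_hasEigenvector
  obtain ⟨k, -, hk⟩ := hT.exists_order hc hp hμ hf.apply_eq_smul hf.2
  set E := Module.End.eigenspace T.toLinearMap μ
  have hinj : Injective ((DSpace.derivCLM M k p).toLinearMap ∘ₗ E.subtype) :=
    (injective_iff_map_eq_zero _).2 fun g hg => by
      by_contra hg0
      exact hT.deriv_ne_zero hc hp hμ hk (Module.End.mem_eigenspace_iff.1 g.2)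
        (mt Submodule.coe_eq_zero.1 hg0) hg
  have hfin : FiniteDimensional ℂ E := .of_injective _ hinj
  have hnontriv : Nontrivial E := Submodule.nontrivial_iff_ne_bot.2 hev
  refine le_antisymm ?_ Module.finrank_pos
  exact (LinearMap.finrank_le_finrank_of_injective hinj).trans_eq (Module.finrank_self ℂ)
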